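/- Every finite simple planar graph (that is, every finite simple graph that can be drawn in the Euclidean plane, with vertices as distinct points and edges as simple arcs between their ends, so that no arc passes through a vertex other than its ends and two different arcs meet only in common ends) that contains no cycle of length $\ell$ for any $\ell$ with $4 \le \ell \le 11$ is $3$-colorable, i.e. its vertices can be colored with at most $3$ colors so that adjacent vertices receive different colors. -/

import Mathlib

/-- `A` is a (simple) arc in the Euclidean plane with endpoints `x` and `y`: the image of an
injective continuous map from the closed unit interval to the plane that sends `0` to `x` and
`1` to `y`. -/
def IsPlaneArc (x y : EuclideanSpace ℝ (Fin 2)) (A : Set (EuclideanSpace ℝ (Fin 2))) : Prop :=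
  ∃ γ : Path x y, Function.Injective γ ∧ Set.range γ = A

/-- A drawing of the simple graph `G` in the Euclidean plane without crossings: distinct vertices
are distinct points, every edge is an arc between its two ends, an arc passes through no vertices
other than its ends, and two different arcs meet only in common ends. -/
structure PlaneDrawing {V : Type*} (G : SimpleGraph V) where
  /-- the point that represents a vertex -/
  point : V → EuclideanSpace ℝ (Fin 2)
  /-- the arc that represents an edge -/
  arc : G.edgeSet → Set (EuclideanSpace ℝ (Fin 2))
  point_injective : Function.Injective point
  isPlaneArc : ∀ (u v : V) (h : G.Adj u v), IsPlaneArc (point u) (point v) (arc ⟨s(u, v), h⟩)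
  mem_of_point_mem_arc : ∀ (e : G.edgeSet) (w : V), point w ∈ arc e → w ∈ (e : Sym2 V)
  arc_inter_arc : ∀ e f : G.edgeSet, e ≠ f →
    arc e ∩ arc f ⊆ point '' {w : V | w ∈ (e : Sym2 V) ∧ w ∈ (f : Sym2 V)}

/-- A graph is planar if it can be drawn in the plane without crossings. -/
def IsPlanarGraph {V : Type*} (G : SimpleGraph V) : Prop :=
  Nonempty (PlaneDrawing G)

/-! It suffices to find a vertex of degree at most 2: delete it, colour the rest by induction, and
extend the colouring. Such a vertex comes from a counting form of Euler's formula, with faces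
replaced by a basis of the cycle space over `ZMod 2`.

Planarity enters through the easy half of MacLane's criterion: the cycle space is spanned by face
vectors such that each edge lies in at most two of them (`IsGridMinor.exists_span_faceVec_eq`). To
avoid the Jordan curve theorem, the drawing is first turned into a minor of the square grid
(`IsPlanarGraph.isGridMinor`), where the required homology is an explicit sum (`exists_jump_eq`).

Let n, E, T count vertices, edges and triangles, and let B be a basis chosen among the face vectors.
Then |B| > E - n, and the weights in B sum to at most 2E. An element of weight below 12 is a sum of
triangles (`mem_triangleSpace_of_weight_lt`), so at most T members of B are that light, and these
still have weight at least 3; hence 12|B| ≤ 2E + 9T. If all degrees were at least 3, then, as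
triangles at a vertex share no edge, 12 + 3t(v) ≤ 5d(v) for the number t(v) of triangles at v;
summing gives 12n + 9T ≤ 10E. Together 12E < 12|B| + 12n ≤ 12E, a contradiction. -/

/-- The double sum over a finite set of a symmetric function with zero diagonal vanishes
modulo two. -/
theorem sum_sum_symm_eq_zero {α : Type*} (s : Finset α) (f : α → α → ZMod 2)
    (hsymm : ∀ x y, f x y = f y x) (hdiag : ∀ x, f x x = 0) :
    ∑ x ∈ s, ∑ y ∈ s, f x y = 0 := by
  classical
  rw [← Finset.sum_product']
  refine Finset.sum_involution (fun p _ => p.swap) ?_ ?_ ?_ ?_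
  · rintro ⟨a, b⟩ _
    simp only [Prod.fst_swap, Prod.snd_swap, hsymm b a]
    exact CharTwo.add_self_eq_zero _
  · rintro ⟨a, b⟩ _ h heq
    simp only [Prod.swap_prod_mk, Prod.mk.injEq] at heq
    obtain ⟨rfl, -⟩ := heq
    exact h (hdiag _)
  · rintro ⟨a, b⟩ h
    simpa [and_comm] using h
  · rintro ⟨a, b⟩ _
    rfl

/-! ### The cycle space modulo two -/

namespace SimpleGraph

variable {V : Type*} {G : SimpleGraph V}

/-- The graph of the edges where a function on pairs does not vanish. -/
def supportGraph (G : SimpleGraph V) (z : Sym2 V → ZMod 2) : SimpleGraph V where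
  Adj u v := G.Adj u v ∧ z s(u, v) ≠ 0
  symm := ⟨fun u v h => ⟨h.1.symm, by rw [Sym2.eq_swap]; exact h.2⟩⟩
  loopless := ⟨fun u h => h.1.ne rfl⟩

theorem supportGraph_le (z : Sym2 V → ZMod 2) : G.supportGraph z ≤ G := fun _ _ h => h.1

/-- Extension by zero of a function on the edges of a graph. -/
noncomputable def edgeExtend (G : SimpleGraph V) :
    (G.edgeSet → ZMod 2) →ₗ[ZMod 2] (Sym2 V → ZMod 2) := by
  classical exact
  { toFun := fun z e => if h : e ∈ G.edgeSet then z ⟨e, h⟩ else 0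
    map_add' := fun a b => by ext e; by_cases h : e ∈ G.edgeSet <;> simp [h]
    map_smul' := fun a b => by ext e; by_cases h : e ∈ G.edgeSet <;> simp [h] }

theorem edgeExtend_of_mem (z : G.edgeSet → ZMod 2) {e : Sym2 V} (h : e ∈ G.edgeSet) :
    G.edgeExtend z e = z ⟨e, h⟩ := by simp [edgeExtend, h]

theorem edgeExtend_of_notMem (z : G.edgeSet → ZMod 2) {e : Sym2 V} (h : e ∉ G.edgeSet) :
    G.edgeExtend z e = 0 := by simp [edgeExtend, h]

theorem edgeExtend_injective : Function.Injective G.edgeExtend := by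
  intro a b h
  ext ⟨e, he⟩
  rw [← edgeExtend_of_mem a he, h, edgeExtend_of_mem]

variable [Fintype V]

/-- The cycle space of a graph over the field with two elements: sets of edges that meet every
vertex an even number of times. -/
def cycleSpace (G : SimpleGraph V) : Submodule (ZMod 2) (Sym2 V → ZMod 2) where
  carrier := {z | (∀ e, e ∉ G.edgeSet → z e = 0) ∧ ∀ v, ∑ w, z s(v, w) = 0}
  add_mem' := by
    rintro a b ⟨ha, ha'⟩ ⟨hb, hb'⟩
    refine ⟨fun e he => by simp [ha e he, hb e he], fun v => ?_⟩
    simp [Finset.sum_add_distrib, ha', hb']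
  zero_mem' := by simp
  smul_mem' := by
    rintro c a ⟨ha, ha'⟩
    refine ⟨fun e he => by simp [ha e he], fun v => ?_⟩
    simp [← Finset.mul_sum, ha']

/-- In a forest every edge uv is a bridge. Summing the degrees over the side of u counts inner edges
twice and uv once, so the sum would be odd. -/
theorem not_isAcyclic_supportGraph {z : Sym2 V → ZMod 2} (hz : z ∈ G.cycleSpace) (h0 : z ≠ 0) :
    ¬ (G.supportGraph z).IsAcyclic := by
  classical
  intro hac
  obtain ⟨e, he⟩ : ∃ e, z e ≠ 0 := Function.ne_iff.1 h0
  induction e with | _ u v => ?_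
  have huv : G.Adj u v := by
    by_contra h
    exact he (hz.1 _ h)
  have hb := (isAcyclic_iff_forall_adj_isBridge.1 hac) (show (G.supportGraph z).Adj u v from ⟨huv, he⟩)
  rw [isBridge_iff] at hb
  set H := (G.supportGraph z).deleteEdges {s(u, v)} with hH
  let A : Finset V := Finset.univ.filter (fun x => H.Reachable u x)
  have hvA : v ∉ A := by simpa [A] using hb
  have huA : u ∈ A := by simp [A]
  have h1 : ∑ x ∈ A, ∑ y, z s(x, y) = 0 := Finset.sum_eq_zero fun x _ => hz.2 x
  have h2 : ∑ x ∈ A, ∑ y ∈ A, z s(x, y) = 0 :=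
    sum_sum_symm_eq_zero A (fun x y => z s(x, y)) (fun x y => by rw [Sym2.eq_swap])
      (fun x => hz.1 _ (by simp))
  have h3 : ∑ x ∈ A, ∑ y ∈ Aᶜ, z s(x, y) = 0 := by
    rw [← h1, ← add_zero (∑ x ∈ A, ∑ y ∈ Aᶜ, z s(x, y)), ← h2, ← Finset.sum_add_distrib]
    exact Finset.sum_congr rfl fun x _ => Finset.sum_compl_add_sum A _
  have key : ∀ x ∈ A, ∀ y ∈ Aᶜ, z s(x, y) ≠ 0 → x = u ∧ y = v := by
    intro x hx y hy hxy
    have hadj : G.Adj x y := by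
      by_contra h
      exact hxy (hz.1 _ h)
    have hx' : H.Reachable u x := by simpa [A] using hx
    have hy' : ¬ H.Reachable u y := by simpa [A] using hy
    have : ¬ H.Adj x y := fun h => hy' (hx'.trans h.reachable)
    rw [hH] at this
    have h4 : s(x, y) = s(u, v) := by
      by_contra h5
      apply this
      rw [deleteEdges_adj]
      exact ⟨⟨hadj, hxy⟩, fun h6 => h5 h6⟩
    rcases Sym2.eq_iff.1 h4 with h | ⟨rfl, rfl⟩
    · exact h
    · exact absurd hx hvA
  rw [Finset.sum_eq_single_of_mem u huA, Finset.sum_eq_single_of_mem v (by simpa using hvA)] at h3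
  · exact he h3
  · intro y hy hyv
    by_contra h
    exact hyv (key u huA y hy h).2
  · intro x hx hxu
    refine Finset.sum_eq_zero fun y hy => ?_
    by_contra h
    exact hxu (key x hx y hy h).1

/-- The number of edges of an element of the cycle space. -/
noncomputable def weight (z : Sym2 V → ZMod 2) : ℕ := by
  classical exact (Finset.univ.filter fun e => z e ≠ 0).card

theorem exists_isCycle_of_mem_cycleSpace {z : Sym2 V → ZMod 2} (hz : z ∈ G.cycleSpace)
    (h0 : z ≠ 0) :
    ∃ (v : V) (c : (G.supportGraph z).Walk v v), c.IsCycle ∧ c.length ≤ weight z := by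
  classical
  have := not_isAcyclic_supportGraph hz h0
  simp only [IsAcyclic, not_forall, not_not] at this
  obtain ⟨v, c, hc⟩ := this
  refine ⟨v, c, hc, ?_⟩
  rw [← Walk.length_edges, ← List.toFinset_card_of_nodup hc.edges_nodup, weight]
  refine Finset.card_le_card fun e he => ?_
  have he' := c.edges_subset_edgeSet (List.mem_toFinset.1 he)
  induction e with | _ a b => ?_
  simpa using he'.2

/-! ### Triangles in the cycle space -/

/-- The indicator function of the edges of the complete graph on a set of vertices. -/
noncomputable def cliqueVec (s : Finset V) : Sym2 V → ZMod 2 := by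
  classical exact fun e => if (∀ v ∈ e, v ∈ s) ∧ ¬ e.IsDiag then 1 else 0

theorem cliqueVec_mk [DecidableEq V] (s : Finset V) (a b : V) :
    cliqueVec s s(a, b) = if a ∈ s ∧ b ∈ s ∧ a ≠ b then 1 else 0 := by
  simp [cliqueVec, and_assoc]

theorem cliqueVec_mem_cycleSpace {s : Finset V} (hs : G.IsNClique 3 s) :
    cliqueVec s ∈ G.cycleSpace := by
  classical
  refine ⟨fun e he => ?_, fun v => ?_⟩
  · induction e with | _ a b => ?_
    rw [cliqueVec_mk, if_neg]
    rintro ⟨ha, hb, hab⟩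
    exact he (hs.1 ha hb hab)
  · simp only [cliqueVec_mk]
    by_cases hv : v ∈ s
    · rw [Finset.sum_boole]
      have : (Finset.univ.filter fun w => v ∈ s ∧ w ∈ s ∧ v ≠ w) = s.erase v := by
        ext w
        simp [hv, and_comm, eq_comm]
      rw [this, Finset.card_erase_of_mem hv, hs.2]
      rfl
    · simp [hv]

/-- The space spanned by the triangles of a graph. -/
noncomputable def triangleSpace (G : SimpleGraph V) : Submodule (ZMod 2) (Sym2 V → ZMod 2) :=
  Submodule.span (ZMod 2) (cliqueVec '' {s : Finset V | G.IsNClique 3 s})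

theorem finrank_triangleSpace_le [DecidableEq V] [DecidableRel G.Adj] :
    Module.finrank (ZMod 2) G.triangleSpace ≤ (G.cliqueFinset 3).card := by
  classical
  have : (cliqueVec '' {s : Finset V | G.IsNClique 3 s}) =
      (((G.cliqueFinset 3).image cliqueVec : Finset (Sym2 V → ZMod 2)) :
        Set (Sym2 V → ZMod 2)) := by
    ext; simp
  rw [triangleSpace, this]
  exact (finrank_span_finset_le_card _).trans Finset.card_image_le

theorem three_le_weight {z : Sym2 V → ZMod 2} (hz : z ∈ G.cycleSpace) (h0 : z ≠ 0) :
    3 ≤ weight z := by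
  obtain ⟨v, c, hc, hle⟩ := exists_isCycle_of_mem_cycleSpace hz h0
  exact hc.three_le_length.trans hle

/-- The support of a nonzero element contains a cycle with at most 11 edges, which must be a
triangle. Subtracting it lowers the weight, and induction applies. -/
theorem mem_triangleSpace_of_weight_lt
    (hcycles : ∀ (v : V) (c : G.Walk v v), c.IsCycle → ¬ (4 ≤ c.length ∧ c.length ≤ 11))
    {z : Sym2 V → ZMod 2} (hz : z ∈ G.cycleSpace) (hw : weight z < 12) :
    z ∈ G.triangleSpace := by
  classical
  induction hn : weight z using Nat.strong_induction_on generalizing z with | _ n ih => ?_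
  by_cases h0 : z = 0
  · rw [h0]; exact zero_mem _
  obtain ⟨v, c, hc, hle⟩ := exists_isCycle_of_mem_cycleSpace hz h0
  have h3 := hc.three_le_length
  have h4 := hcycles v (c.mapLe (supportGraph_le z)) (hc.mapLe _)
  rw [Walk.length_mapLe] at h4
  have hlen : c.length = 3 := by omega
  obtain ⟨s, hs⟩ := is3Clique_iff_exists_cycle_length_three.2 ⟨v, c, hc, hlen⟩
  have hsG : G.IsNClique 3 s := hs.mono (supportGraph_le z)
  have hmem : cliqueVec s ∈ G.triangleSpace := Submodule.subset_span ⟨s, hsG, rfl⟩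
  have hone : ∀ a : ZMod 2, a ≠ 0 → a = 1 := by decide
  have hsub : ∀ e, cliqueVec s e ≠ 0 → z e ≠ 0 := by
    intro e
    induction e with | _ a b => ?_
    rw [cliqueVec_mk]
    intro h
    have h' : a ∈ s ∧ b ∈ s ∧ a ≠ b := by
      by_contra h'
      simp [h'] at h
    exact (hs.1 h'.1 h'.2.1 h'.2.2).2
  -- The triangle lies inside the support of `z`, so adding it only deletes edges.
  have hlt : weight (z + cliqueVec s) < weight z := by
    refine Finset.card_lt_card ⟨fun e he => ?_, fun hsup => ?_⟩
    · simp only [Finset.mem_filter, Finset.mem_univ, true_and, Pi.add_apply] at he ⊢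
      intro h
      rw [h, zero_add] at he
      exact hsub e he h
    · obtain ⟨a, b, hab, ha, hb⟩ : ∃ a b, a ≠ b ∧ a ∈ s ∧ b ∈ s := by
        have : 1 < s.card := by rw [hs.2]; norm_num
        obtain ⟨a, ha, b, hb, hab⟩ := Finset.one_lt_card.1 this
        exact ⟨a, b, hab, ha, hb⟩
      have h1 : cliqueVec s s(a, b) = 1 := by rw [cliqueVec_mk, if_pos ⟨ha, hb, hab⟩]
      have h2 : z s(a, b) = 1 := hone _ (hsub _ (by rw [h1]; exact one_ne_zero))
      have := @hsup s(a, b) (by simp [h2])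
      simp only [Finset.mem_filter, Finset.mem_univ, true_and, Pi.add_apply, h1, h2] at this
      exact this rfl
  have := ih _ (hn ▸ hlt) (add_mem hz (cliqueVec_mem_cycleSpace hsG)) (hlt.trans hw) rfl
  simpa using sub_mem this hmem

/-! ### Dimension of the cycle space and face bases -/

/-- The degrees modulo two of a set of pairs. -/
def boundary : (Sym2 V → ZMod 2) →ₗ[ZMod 2] (V → ZMod 2) where
  toFun z v := ∑ w, z s(v, w)
  map_add' a b := by ext v; simp [Finset.sum_add_distrib]
  map_smul' c a := by ext v; simp [Finset.mul_sum]

/-- Rank-nullity for the boundary map. The entries of a boundary sum to zero, so the indicator of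
one vertex is not in the range and the rank is less than the number of vertices. Connectedness plays
no role, since only this inequality is needed. -/
theorem card_edgeSet_lt_finrank_cycleSpace_add [Nonempty V] :
    Nat.card G.edgeSet < Module.finrank (ZMod 2) G.cycleSpace + Fintype.card V := by
  classical
  let f : (G.edgeSet → ZMod 2) →ₗ[ZMod 2] (V → ZMod 2) := boundary ∘ₗ G.edgeExtend
  have h1 := LinearMap.finrank_range_add_finrank_ker f
  have h2 : Module.finrank (ZMod 2) (LinearMap.ker f) ≤
      Module.finrank (ZMod 2) G.cycleSpace := by
    rw [(Submodule.equivMapOfInjective G.edgeExtend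
      edgeExtend_injective (LinearMap.ker f)).finrank_eq]
    refine Submodule.finrank_mono ?_
    rintro _ ⟨z, hz, rfl⟩
    exact ⟨fun e he => edgeExtend_of_notMem z he, fun v => congrFun hz v⟩
  have h3 : Module.finrank (ZMod 2) (LinearMap.range f) < Fintype.card V := by
    rw [← Module.finrank_fintype_fun_eq_card (ZMod 2) (η := V)]
    refine Submodule.finrank_lt fun htop => ?_
    obtain ⟨v⟩ := ‹Nonempty V›
    obtain ⟨z, hz⟩ : Pi.single v 1 ∈ LinearMap.range f := htop ▸ Submodule.mem_top
    have h4 : ∑ x, f z x = 0 :=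
      sum_sum_symm_eq_zero Finset.univ (fun x y => G.edgeExtend z s(x, y))
        (fun x y => by rw [Sym2.eq_swap]) (fun x => edgeExtend_of_notMem z (by simp))
    rw [hz] at h4
    simp at h4
  rw [Module.finrank_fintype_fun_eq_card, ← Nat.card_eq_fintype_card] at h1
  omega

/-- The boundary of a face, when the two sides of every edge are given. -/
noncomputable def faceVec {Q : Type*} (G : SimpleGraph V) (L R : Sym2 V → Q) (q : Q) :
    Sym2 V → ZMod 2 := by
  classical exact fun e =>
    if e ∈ G.edgeSet then (if L e = q then 1 else 0) + (if R e = q then 1 else 0) else 0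

theorem exists_basis_cycleSpace {Q : Type*} [Nonempty Q] (L R : Sym2 V → Q)
    (hspan : Submodule.span (ZMod 2) (Set.range (G.faceVec L R)) = G.cycleSpace) :
    ∃ B : Finset (Sym2 V → ZMod 2), (B.card = Module.finrank (ZMod 2) G.cycleSpace) ∧
      (LinearIndependent (ZMod 2) ((↑) : B → Sym2 V → ZMod 2)) ∧
      (∀ b ∈ B, b ∈ G.cycleSpace) ∧
      ∑ b ∈ B, weight b ≤ 2 * Nat.card G.edgeSet := by
  classical
  obtain ⟨b, hsub, hsp, hli⟩ :=
    exists_linearIndependent (ZMod 2) (Set.range (G.faceVec L R))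
  have hfin : b.Finite := Set.toFinite b
  have hB : ∀ β ∈ b, β ∈ G.cycleSpace := fun β hβ => by
    rw [← hspan]; exact Submodule.subset_span (hsub hβ)
  lift b to Finset (Sym2 V → ZMod 2) using hfin
  refine ⟨b, ?_, hli, hB, ?_⟩
  · rw [← hspan, ← hsp]
    exact (finrank_span_finset_eq_card hli).symm
  · choose! q hq using hsub
    have hw : ∀ β ∈ b, weight β = ∑ e ∈ G.edgeFinset, if β e ≠ 0 then 1 else 0 := by
      intro β hβ
      rw [weight, Finset.card_filter, ← Finset.sum_subset (Finset.subset_univ G.edgeFinset)]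
      intro e _ he
      rw [if_neg]
      rw [not_not]
      exact (hB β hβ).1 e (by simpa using he)
    rw [Finset.sum_congr rfl hw, Finset.sum_comm, Nat.card_eq_fintype_card,
      ← edgeFinset_card, mul_comm, ← smul_eq_mul]
    refine Finset.sum_le_card_nsmul _ _ _ fun e he => ?_
    rw [← Finset.card_filter]
    -- A basis vector containing `e` is the face vector of `L e` or of `R e`, and `q` is injective
    -- because the face determines the vector.
    refine (Finset.card_le_card_of_injOn q (t := {L e, R e}) ?_ ?_).trans Finset.card_le_two
    · intro β hβ
      simp only [Finset.coe_filter, Set.mem_ofPred_eq] at hβ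
      obtain ⟨hβ, hne⟩ := hβ
      rw [← hq hβ] at hne
      by_contra hcon
      simp only [Finset.coe_insert, Finset.coe_singleton, Set.mem_insert_iff,
        Set.mem_singleton_iff, not_or] at hcon
      apply hne
      simp [faceVec, Ne.symm hcon.1, Ne.symm hcon.2]
    · intro β hβ β' hβ' h
      simp only [Finset.coe_filter, Set.mem_ofPred_eq] at hβ hβ'
      rw [← hq hβ.1, ← hq hβ'.1, h]

/-! ### Counting: a vertex of degree at most two -/

/-- Two triangles vab and vac with b ≠ c would give the 4-cycle v, b, a, c. So the triangles at `v`
use disjoint pairs of neighbours. -/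
theorem card_triangles_at_vertex_le [DecidableEq V] [DecidableRel G.Adj]
    (h4 : ∀ (v : V) (c : G.Walk v v), c.IsCycle → c.length ≠ 4) (v : V) :
    2 * ((G.cliqueFinset 3).filter fun s => v ∈ s).card ≤ G.degree v := by
  have hcard : ∀ s ∈ (G.cliqueFinset 3).filter (fun s => v ∈ s), (s.erase v).card = 2 := by
    intro s hs
    simp only [Finset.mem_filter, mem_cliqueFinset_iff] at hs
    rw [Finset.card_erase_of_mem hs.2, hs.1.2]
  rw [mul_comm, ← Finset.sum_const_nat hcard, ← Finset.card_biUnion, ← card_neighborFinset_eq_degree]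
  · refine Finset.card_le_card fun w hw => ?_
    simp only [Finset.mem_biUnion, Finset.mem_filter, mem_cliqueFinset_iff, Finset.mem_erase] at hw
    obtain ⟨s, ⟨hs, hv⟩, hne, hws⟩ := hw
    rw [mem_neighborFinset]
    exact hs.1 hv hws hne.symm
  · intro s hs t ht hst
    rw [Function.onFun, Finset.disjoint_left]
    intro a has hat
    apply hst
    have hs2 := hcard s hs
    have ht2 := hcard t ht
    simp only [Finset.mem_coe, Finset.mem_filter, mem_cliqueFinset_iff] at hs ht
    obtain ⟨b, hb⟩ : ∃ b, (s.erase v).erase a = {b} := by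
      rw [← Finset.card_eq_one, Finset.card_erase_of_mem has, hs2]
    obtain ⟨c, hc⟩ : ∃ c, (t.erase v).erase a = {c} := by
      rw [← Finset.card_eq_one, Finset.card_erase_of_mem hat, ht2]
    have hs' : s = insert v (insert a {b}) := by
      rw [← hb, Finset.insert_erase has, Finset.insert_erase hs.2]
    have ht' : t = insert v (insert a {c}) := by
      rw [← hc, Finset.insert_erase hat, Finset.insert_erase ht.2]
    have hbm : b ∈ (s.erase v).erase a := by simp [hb]
    have hcm : c ∈ (t.erase v).erase a := by simp [hc]
    simp only [Finset.mem_erase] at hbm hcm has hat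
    by_cases hbc : b = c
    · rw [hs', ht', hbc]
    exfalso
    have e1 : G.Adj v b := hs.1.1 hs.2 hbm.2.2 hbm.2.1.symm
    have e2 : G.Adj b a := hs.1.1 hbm.2.2 has.2 hbm.1
    have e3 : G.Adj a c := ht.1.1 hat.2 hcm.2.2 hcm.1.symm
    have e4 : G.Adj c v := ht.1.1 hcm.2.2 ht.2 hcm.2.1
    refine h4 v (.cons e1 (.cons e2 (.cons e3 (.cons e4 .nil)))) ?_ rfl
    have hva : v ≠ a := has.1.symm
    rw [Walk.isCycle_def, Walk.isTrail_def]
    simp [hbc, hbm.1, hbm.2.1, hcm.2.1, hva, hva.symm, Ne.symm hbm.2.1, Ne.symm hcm.1,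
      Ne.symm hcm.2.1]

theorem exists_degree_le_two [Nonempty V] [DecidableEq V] [DecidableRel G.Adj]
    {Q : Type*} (L R : Sym2 V → Q)
    (hspan : Submodule.span (ZMod 2) (Set.range (G.faceVec L R)) = G.cycleSpace)
    (hcycles : ∀ (v : V) (c : G.Walk v v), c.IsCycle → ¬ (4 ≤ c.length ∧ c.length ≤ 11)) :
    ∃ v, G.degree v ≤ 2 := by
  classical
  by_contra! hdeg
  have : Nonempty Q := ‹Nonempty V›.map fun v => L s(v, v)
  obtain ⟨B, hcard, hli, hmem, hsum⟩ := exists_basis_cycleSpace L R hspan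
  have hdim := card_edgeSet_lt_finrank_cycleSpace_add (G := G)
  have hdegsum := G.sum_degrees_eq_twice_card_edges
  rw [← hcard, Nat.card_eq_fintype_card, ← edgeFinset_card] at hdim
  rw [Nat.card_eq_fintype_card, ← edgeFinset_card] at hsum
  have hT : (B.filter fun b => b ∈ G.triangleSpace).card ≤ (G.cliqueFinset 3).card := by
    refine le_trans ?_ (finrank_triangleSpace_le (G := G))
    have hli' : LinearIndependent (ZMod 2)
        ((↑) : (B.filter fun b => b ∈ G.triangleSpace : Finset _) → Sym2 V → ZMod 2) :=
      LinearIndepOn.mono (s := (B : Set (Sym2 V → ZMod 2))) (v := id) hli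
        (by intro b hb; exact (Finset.mem_filter.1 hb).1)
    rw [← finrank_span_finset_eq_card hli']
    refine Submodule.finrank_mono (Submodule.span_le.2 fun b hb => ?_)
    exact (Finset.mem_filter.1 hb).2
  -- Members of the triangle space have weight at least 3, whence the correction 9 = 12 - 3.
  have hweight : ∀ b ∈ B, 12 ≤ weight b + (if b ∈ G.triangleSpace then 9 else 0) := by
    intro b hb
    by_cases hbT : b ∈ G.triangleSpace
    · have := three_le_weight (hmem b hb) (hli.ne_zero (⟨b, hb⟩ : B))
      simp only [hbT, if_true]
      omega
    · by_contra hlt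
      simp only [hbT, if_false] at hlt
      exact hbT (mem_triangleSpace_of_weight_lt hcycles (hmem b hb) (by omega))
  have h12 : 12 * B.card ≤ 2 * G.edgeFinset.card + 9 * (G.cliqueFinset 3).card := by
    have h := Finset.card_nsmul_le_sum B _ 12 hweight
    rw [Finset.sum_add_distrib, ← Finset.sum_filter, Finset.sum_const, smul_eq_mul,
      smul_eq_mul] at h
    omega
  have htri : 3 * (G.cliqueFinset 3).card =
      ∑ v, ((G.cliqueFinset 3).filter fun s => v ∈ s).card := by
    simp only [Finset.card_filter]
    rw [Finset.sum_comm, mul_comm]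
    refine (Finset.sum_const_nat fun s hs => ?_).symm
    rw [← Finset.card_filter]
    simpa using ((mem_cliqueFinset_iff.1 hs).2)
  -- Tight at degree 3, where integrality allows only one triangle; from degree 4 on, t ≤ d/2
  -- suffices.
  have hv : ∀ v, 12 + 3 * ((G.cliqueFinset 3).filter fun s => v ∈ s).card ≤ 5 * G.degree v := by
    intro v
    have h1 := card_triangles_at_vertex_le
      (fun v c hc h => hcycles v c hc (by omega)) (G := G) v
    have h2 := hdeg v
    omega
  have hvsum := Finset.sum_le_sum fun v (_ : v ∈ Finset.univ) => hv v
  rw [Finset.sum_add_distrib, ← Finset.mul_sum, ← Finset.mul_sum, ← htri, hdegsum,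
    Finset.sum_const, smul_eq_mul, Finset.card_univ] at hvsum
  omega

end SimpleGraph

/-! ### Homology of the square grid modulo two -/

namespace Grid

/-- The four neighbours of a vertex of the square grid. -/
def nbrs (x : ℤ × ℤ) : Finset (ℤ × ℤ) :=
  {(x.1 + 1, x.2), (x.1 - 1, x.2), (x.1, x.2 + 1), (x.1, x.2 - 1)}

theorem mem_nbrs {x y : ℤ × ℤ} : y ∈ nbrs x ↔ y = (x.1 + 1, x.2) ∨ y = (x.1 - 1, x.2) ∨
    y = (x.1, x.2 + 1) ∨ y = (x.1, x.2 - 1) := by simp [nbrs]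

theorem mem_nbrs_comm {x y : ℤ × ℤ} : y ∈ nbrs x ↔ x ∈ nbrs y := by
  simp only [mem_nbrs, Prod.ext_iff]
  omega

theorem notMem_nbrs_self (x : ℤ × ℤ) : x ∉ nbrs x := by
  simp only [mem_nbrs, Prod.ext_iff]
  omega

theorem sum_nbrs {M : Type*} [AddCommMonoid M] (x : ℤ × ℤ) (f : ℤ × ℤ → M) :
    ∑ y ∈ nbrs x, f y =
      f (x.1 + 1, x.2) + (f (x.1 - 1, x.2) + (f (x.1, x.2 + 1) + f (x.1, x.2 - 1))) := by
  rw [nbrs, Finset.sum_insert, Finset.sum_insert, Finset.sum_insert, Finset.sum_singleton] <;>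
  · simp only [Finset.mem_insert, Finset.mem_singleton, Prod.ext_iff]
    omega

/-- A set of grid vertices is connected if every property that passes between neighbours in the
set passes between any two of its members. -/
def IsConn (S : Set (ℤ × ℤ)) : Prop :=
  ∀ P : ℤ × ℤ → Prop, (∀ x ∈ S, ∀ y ∈ S, y ∈ nbrs x → P x → P y) →
    ∀ x ∈ S, ∀ y ∈ S, P x → P y

/-- One of the two faces of the grid that contain a given edge. -/
def sideA (x y : ℤ × ℤ) : ℤ × ℤ := (min x.1 y.1, min x.2 y.2)

/-- The other one of the two faces of the grid that contain a given edge. -/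
def sideB (x y : ℤ × ℤ) : ℤ × ℤ := (max x.1 y.1 - 1, max x.2 y.2 - 1)

theorem sideA_comm (x y : ℤ × ℤ) : sideA x y = sideA y x := by
  simp [sideA, min_comm]

theorem sideB_comm (x y : ℤ × ℤ) : sideB x y = sideB y x := by
  simp [sideB, max_comm]

/-- The coboundary of a function on the faces of the grid. -/
def jump (w : ℤ × ℤ → ZMod 2) (x y : ℤ × ℤ) : ZMod 2 :=
  if y ∈ nbrs x then w (sideA x y) + w (sideB x y) else 0

theorem jump_comm (w : ℤ × ℤ → ZMod 2) (x y : ℤ × ℤ) : jump w x y = jump w y x := by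
  simp only [jump, mem_nbrs_comm (x := x), sideA_comm x, sideB_comm x]

theorem jump_self (w : ℤ × ℤ → ZMod 2) (x : ℤ × ℤ) : jump w x x = 0 :=
  if_neg (notMem_nbrs_self x)

/-- Each of the four faces around `x` borders two of the four edges at `x`, so it is counted twice.
-/
theorem sum_jump (w : ℤ × ℤ → ZMod 2) (x : ℤ × ℤ) : ∑ y ∈ nbrs x, jump w x y = 0 := by
  have h : ∀ y ∈ nbrs x, jump w x y = w (sideA x y) + w (sideB x y) := fun y hy => if_pos hy
  rw [Finset.sum_congr rfl h, sum_nbrs]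
  obtain ⟨a, b⟩ := x
  have e1 : min a (a + 1) = a := by omega
  have e2 : max a (a + 1) - 1 = a := by omega
  have e3 : min a (a - 1) = a - 1 := by omega
  have e4 : max a (a - 1) - 1 = a - 1 := by omega
  have e5 : min b (b + 1) = b := by omega
  have e6 : max b (b + 1) - 1 = b := by omega
  have e7 : min b (b - 1) = b - 1 := by omega
  have e8 : max b (b - 1) - 1 = b - 1 := by omega
  simp only [sideA, sideB, e1, e2, e3, e4, e5, e6, e7, e8, min_self, max_self]
  have h2 : (2 : ZMod 2) = 0 := rfl
  linear_combination (w (a, b) + w (a, b - 1) + w (a - 1, b) + w (a - 1, b - 1)) * h2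

theorem sum_nbrs_single {x y : ℤ × ℤ} (h : y ∈ nbrs x) (a : ℤ × ℤ) :
    ∑ b ∈ nbrs a, (Finsupp.single s(x, y) (1 : ZMod 2)) s(a, b) =
      (if a = x then 1 else 0) + (if a = y then 1 else 0) := by
  have hxy : x ≠ y := by
    rintro rfl
    exact notMem_nbrs_self _ h
  simp only [Finsupp.single_apply]
  by_cases hax : a = x
  · subst hax
    rw [Finset.sum_eq_single_of_mem y h]
    · simp [hxy]
    · intro b _ hb
      rw [if_neg]
      simp [Ne.symm hb, hxy.symm]
  by_cases hay : a = y
  · subst hay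
    rw [Finset.sum_eq_single_of_mem x (mem_nbrs_comm.1 h)]
    · simp [hax]
    · intro b _ hb
      rw [if_neg]
      simp [Ne.symm hb, hxy]
  · rw [Finset.sum_eq_zero]
    · simp [hax, hay]
    · intro b _
      rw [if_neg]
      simp [Ne.symm hax, Ne.symm hay]

theorem IsConn.exists_chain {S : Set (ℤ × ℤ)} (hS : IsConn S) {x y : ℤ × ℤ} (hx : x ∈ S)
    (hy : y ∈ S) :
    ∃ c : Sym2 (ℤ × ℤ) →₀ ZMod 2, (∀ a b, c s(a, b) ≠ 0 → a ∈ S ∧ b ∈ S) ∧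
      ∀ a, ∑ b ∈ nbrs a, c s(a, b) = (if a = x then 1 else 0) + (if a = y then 1 else 0) := by
  refine hS (fun y => ∃ c : Sym2 (ℤ × ℤ) →₀ ZMod 2, (∀ a b, c s(a, b) ≠ 0 → a ∈ S ∧ b ∈ S) ∧
      ∀ a, ∑ b ∈ nbrs a, c s(a, b) = (if a = x then 1 else 0) + (if a = y then 1 else 0))
    ?_ x hx y hy ⟨0, by simp, fun a => by simp [CharTwo.add_self_eq_zero]⟩
  rintro p hp q hq hpq ⟨c, hc, hc'⟩
  refine ⟨c + Finsupp.single s(p, q) 1, fun a b hab => ?_, fun a => ?_⟩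
  · by_cases h : s(p, q) = s(a, b)
    · rcases Sym2.eq_iff.1 h with ⟨rfl, rfl⟩ | ⟨rfl, rfl⟩
      · exact ⟨hp, hq⟩
      · exact ⟨hq, hp⟩
    · rw [Finsupp.add_apply, Finsupp.single_apply, if_neg h, add_zero] at hab
      exact hc a b hab
  · simp only [Finsupp.add_apply]
    rw [Finset.sum_add_distrib, hc', sum_nbrs_single hpq]
    have h2 : (2 : ZMod 2) = 0 := rfl
    linear_combination (if a = p then 1 else 0) * h2

/-- The first homology of the grid vanishes: a finite cycle is the coboundary of the face function
that counts its crossings with the horizontal ray going left from the face. -/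
theorem exists_jump_eq (c : Sym2 (ℤ × ℤ) →₀ ZMod 2)
    (hc : ∀ x, ∑ y ∈ nbrs x, c s(x, y) = 0) :
    ∃ w, ∀ x, ∀ y ∈ nbrs x, jump w x y = c s(x, y) := by
  classical
  obtain ⟨N, hN⟩ : ∃ N : ℤ, ∀ x y, x.1 < N → c s(x, y) = 0 := by
    obtain ⟨N, hN⟩ := ((c.support.biUnion Sym2.toFinset).image Prod.fst).bddBelow
    refine ⟨N, fun x y hx => ?_⟩
    by_contra h
    have := hN (a := x.1) (by
      simp only [Finset.coe_image, Set.mem_image, Finset.mem_coe, Finset.mem_biUnion]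
      exact ⟨x, ⟨s(x, y), by simpa using h, by simp⟩, rfl⟩)
    omega
  have h2 : (2 : ZMod 2) = 0 := rfl
  let w : ℤ × ℤ → ZMod 2 := fun p => ∑ k ∈ Finset.Icc N p.1, c s((k, p.2), (k, p.2 + 1))
  have hw : ∀ i j, w (i, j) = w (i - 1, j) + c s((i, j), (i, j + 1)) := by
    intro i j
    by_cases hi : N ≤ i
    · have : Finset.Icc N i = insert i (Finset.Icc N (i - 1)) := by
        ext k
        simp only [Finset.mem_Icc, Finset.mem_insert]
        omega
      simp only [w]
      rw [this, Finset.sum_insert (by simp), add_comm]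
    · rw [hN _ _ (by simpa using hi), add_zero]
      simp only [w]
      rw [Finset.Icc_eq_empty (by omega), Finset.Icc_eq_empty (by omega)]
  have hw0 : ∀ i j, i < N → w (i, j) = 0 := by
    intro i j hi
    simp only [w]
    rw [Finset.Icc_eq_empty (by omega), Finset.sum_empty]
  -- Vertical edges are right by construction. For horizontal ones, induct to the right from where
  -- `c` vanishes, using the cycle condition at (i + 1, j).
  have hhor : ∀ j i, w (i, j) + w (i, j - 1) + c s((i, j), (i + 1, j)) = 0 := by
    intro j i
    by_cases hi : i < N
    · rw [hw0 i j hi, hw0 i (j - 1) hi, hN _ _ (by simpa using hi)]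
      simp
    · have hi' : N - 1 ≤ i := by omega
      clear hi
      induction i, hi' using Int.leInduction with
      | base =>
        rw [hw0 _ j (by omega), hw0 _ (j - 1) (by omega), hN _ _ (by simp)]
        simp
      | succ i _ ih =>
        have h := hc (i + 1, j)
        rw [sum_nbrs] at h
        simp only [add_sub_cancel_right] at h
        have h3 := hw (i + 1) j
        have h4 := hw (i + 1) (j - 1)
        simp only [add_sub_cancel_right, sub_add_cancel] at h3 h4
        rw [Sym2.eq_swap (a := (i + 1, j)) (b := (i, j)),
          Sym2.eq_swap (a := (i + 1, j)) (b := (i + 1, j - 1))] at h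
        linear_combination h + h3 + h4 + ih - c s((i, j), (i + 1, j)) * h2
  have hA : ∀ i j, jump w (i, j) (i + 1, j) = c s((i, j), (i + 1, j)) := by
    intro i j
    rw [jump, if_pos (by simp [mem_nbrs])]
    have e1 : min i (i + 1) = i := by omega
    have e2 : max i (i + 1) - 1 = i := by omega
    simp only [sideA, sideB, e1, e2, min_self, max_self]
    linear_combination hhor j i - c s((i, j), (i + 1, j)) * h2
  have hB : ∀ i j, jump w (i, j) (i, j + 1) = c s((i, j), (i, j + 1)) := by
    intro i j
    rw [jump, if_pos (by simp [mem_nbrs])]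
    have e1 : min j (j + 1) = j := by omega
    have e2 : max j (j + 1) - 1 = j := by omega
    simp only [sideA, sideB, e1, e2, min_self, max_self]
    linear_combination hw i j + w (i - 1, j) * h2
  refine ⟨w, ?_⟩
  rintro ⟨i, j⟩ y hy
  rcases mem_nbrs.1 hy with rfl | rfl | rfl | rfl
  · exact hA i j
  · have := hA (i - 1) j
    rw [sub_add_cancel] at this
    rw [jump_comm, Sym2.eq_swap, this]
  · exact hB i j
  · have := hB i (j - 1)
    rw [sub_add_cancel] at this
    rw [jump_comm, Sym2.eq_swap, this]

end Grid

open Grid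

/-! ### Grid minors and their faces -/

namespace SimpleGraph

/-- A graph is a minor of the square grid: its vertices are represented by disjoint nonempty
connected finite sets of grid vertices, and the sets of adjacent vertices are joined by an edge
of the grid. -/
def IsGridMinor {V : Type*} (G : SimpleGraph V) : Prop :=
  ∃ S : V → Finset (ℤ × ℤ), (∀ v, (S v).Nonempty) ∧ (∀ v, IsConn (S v)) ∧
    (∀ u v, u ≠ v → Disjoint (S u) (S v)) ∧
    ∀ u v, G.Adj u v → ∃ x ∈ S u, ∃ y ∈ S v, y ∈ nbrs x

variable {V : Type*} {G : SimpleGraph V}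

theorem IsGridMinor.comap {W : Type*} {H : SimpleGraph W} (h : G.IsGridMinor) (f : H ↪g G) :
    H.IsGridMinor := by
  obtain ⟨S, hne, hconn, hdisj, hadj⟩ := h
  exact ⟨S ∘ f, fun v => hne _, fun v => hconn _, fun u v huv => hdisj _ _ (f.injective.ne huv),
    fun u v huv => hadj _ _ (f.map_adj_iff.2 huv)⟩

/-- A representation of a graph as a minor of the square grid, with a chosen edge of the grid for
every edge of the graph. -/
structure GridModel (G : SimpleGraph V) where
  /-- the set of grid vertices that represents a vertex -/
  S : V → Finset (ℤ × ℤ)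
  nonempty : ∀ v, (S v).Nonempty
  conn : ∀ v, IsConn (S v)
  eq_of_mem : ∀ {u v x}, x ∈ S u → x ∈ S v → u = v
  /-- the first end of an edge -/
  src : G.edgeSet → V
  /-- the second end of an edge -/
  tgt : G.edgeSet → V
  /-- the first end of the grid edge that represents an edge -/
  X : G.edgeSet → ℤ × ℤ
  /-- the second end of the grid edge that represents an edge -/
  Y : G.edgeSet → ℤ × ℤ
  mk_eq : ∀ e, s(src e, tgt e) = e.1
  X_mem : ∀ e, X e ∈ S (src e)
  Y_mem : ∀ e, Y e ∈ S (tgt e)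
  Y_mem_nbrs : ∀ e, Y e ∈ nbrs (X e)

theorem IsGridMinor.nonempty_gridModel (h : G.IsGridMinor) : Nonempty (GridModel G) := by
  obtain ⟨S, hne, hconn, hdisj, hadj⟩ := h
  have : ∀ e : G.edgeSet, ∃ (u v : V) (x y : ℤ × ℤ), s(u, v) = e.1 ∧ x ∈ S u ∧ y ∈ S v ∧
      y ∈ nbrs x := by
    rintro ⟨e, he⟩
    induction e with | _ u v => ?_
    obtain ⟨x, hx, y, hy, hxy⟩ := hadj u v he
    exact ⟨u, v, x, y, rfl, hx, hy, hxy⟩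
  choose src tgt X Y h1 h2 h3 h4 using this
  refine ⟨⟨S, hne, hconn, fun {u v x} hu hv => ?_, src, tgt, X, Y, h1, h2, h3, h4⟩⟩
  by_contra huv
  exact Finset.disjoint_left.1 (hdisj u v huv) hu hv

namespace GridModel

variable (m : GridModel G)

/-- The grid edges of a model: those inside a set that represents a vertex, and those that
represent an edge. -/
def edges : Set (Sym2 (ℤ × ℤ)) :=
  {c | (∃ v, ∃ x ∈ m.S v, ∃ y ∈ m.S v, c = s(x, y)) ∨ ∃ e, c = s(m.X e, m.Y e)}

/-- Two faces of the grid are joined if they share an edge outside of the model. -/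
def faceRel (f g : ℤ × ℤ) : Prop :=
  ∃ x, ∃ y ∈ nbrs x, s(x, y) ∉ m.edges ∧ f = sideA x y ∧ g = sideB x y

theorem src_ne_tgt (e : G.edgeSet) : m.src e ≠ m.tgt e := by
  have := e.2
  rw [← m.mk_eq e] at this
  exact G.ne_of_adj this

theorem jump_eq_zero {w : ℤ × ℤ → ZMod 2} (hw : ∀ f g, m.faceRel f g → w f = w g)
    {x y : ℤ × ℤ} (h : s(x, y) ∉ m.edges) : jump w x y = 0 := by
  by_cases hxy : y ∈ nbrs x
  · rw [jump, if_pos hxy, hw _ _ ⟨x, y, hxy, h, rfl, rfl⟩, CharTwo.add_self_eq_zero]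
  · rw [jump, if_neg hxy]

theorem eq_of_mem_edges {u v : V} (huv : u ≠ v) {x y : ℤ × ℤ} (hx : x ∈ m.S u) (hy : y ∈ m.S v)
    (h : s(x, y) ∈ m.edges) :
    ∃ h : G.Adj u v, s(x, y) = s(m.X ⟨s(u, v), h⟩, m.Y ⟨s(u, v), h⟩) := by
  rcases h with ⟨t, a, ha, b, hb, hab⟩ | ⟨e, he⟩
  · exfalso
    rcases Sym2.eq_iff.1 hab with ⟨rfl, rfl⟩ | ⟨rfl, rfl⟩
    · exact huv ((m.eq_of_mem hx ha).trans (m.eq_of_mem hb hy))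
    · exact huv ((m.eq_of_mem hx hb).trans (m.eq_of_mem ha hy))
  · have h1 : s(u, v) = e.1 := by
      rw [← m.mk_eq e]
      rcases Sym2.eq_iff.1 he with ⟨rfl, rfl⟩ | ⟨rfl, rfl⟩
      · rw [m.eq_of_mem hx (m.X_mem e), m.eq_of_mem hy (m.Y_mem e)]
      · rw [m.eq_of_mem hx (m.Y_mem e), m.eq_of_mem hy (m.X_mem e), Sym2.eq_swap]
    have h2 : G.Adj u v := by rw [← mem_edgeSet, h1]; exact e.2
    refine ⟨h2, ?_⟩
    rw [he]
    obtain rfl : e = ⟨s(u, v), h2⟩ := Subtype.ext h1.symm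
    rfl

theorem exists_ends {u v : V} (h : G.Adj u v) :
    ∃ x ∈ m.S u, ∃ y ∈ m.S v, s(x, y) = s(m.X ⟨s(u, v), h⟩, m.Y ⟨s(u, v), h⟩) := by
  have h1 := m.X_mem ⟨s(u, v), h⟩
  have h2 := m.Y_mem ⟨s(u, v), h⟩
  rcases Sym2.eq_iff.1 (m.mk_eq ⟨s(u, v), h⟩) with ⟨h3, h4⟩ | ⟨h3, h4⟩ <;> rw [h3] at h1 <;>
    rw [h4] at h2
  · exact ⟨_, h1, _, h2, rfl⟩
  · exact ⟨_, h2, _, h1, Sym2.eq_swap⟩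

variable [Fintype V]

/-- The edges of the graph across which a function on faces changes form an element of the cycle
space. -/
theorem jump_mem_cycleSpace {w : ℤ × ℤ → ZMod 2} (hw : ∀ f g, m.faceRel f g → w f = w g)
    (z : Sym2 V → ZMod 2) (hz : ∀ e (h : e ∈ G.edgeSet), z e = jump w (m.X ⟨e, h⟩) (m.Y ⟨e, h⟩))
    (hz' : ∀ e, e ∉ G.edgeSet → z e = 0) : z ∈ G.cycleSpace := by
  classical
  refine ⟨hz', fun v => ?_⟩
  -- Between two different branch sets at most one grid edge can carry a jump, the one representing
  -- the edge vu; inside one branch set, jumps cancel in pairs.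
  have key : ∀ u, ∑ x ∈ m.S v, ∑ y ∈ m.S u, jump w x y = z s(v, u) := by
    intro u
    by_cases huv : v = u
    · subst huv
      rw [hz' _ (by simp)]
      exact sum_sum_symm_eq_zero _ _ (jump_comm w) (jump_self w)
    by_cases hadj : G.Adj v u
    · obtain ⟨a, ha, b, hb, hab⟩ := m.exists_ends hadj
      have hz2 : z s(v, u) = jump w a b := by
        rw [hz _ hadj]
        rcases Sym2.eq_iff.1 hab with ⟨h1, h2⟩ | ⟨h1, h2⟩
        · rw [h1, h2]
        · rw [h1, h2, jump_comm]
      have huniq : ∀ x ∈ m.S v, ∀ y ∈ m.S u, jump w x y ≠ 0 → x = a ∧ y = b := by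
        intro x hx y hy hxy
        have hmem : s(x, y) ∈ m.edges := by
          by_contra h
          exact hxy (m.jump_eq_zero hw h)
        obtain ⟨_, h2⟩ := m.eq_of_mem_edges huv hx hy hmem
        rw [← hab] at h2
        rcases Sym2.eq_iff.1 h2 with h | ⟨rfl, rfl⟩
        · exact h
        · exact absurd (m.eq_of_mem hx hb) huv
      rw [Finset.sum_eq_single_of_mem a ha, Finset.sum_eq_single_of_mem b hb, hz2]
      · intro y hy hyb
        by_contra h
        exact hyb (huniq a ha y hy h).2
      · intro x hx hxa
        refine Finset.sum_eq_zero fun y hy => ?_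
        by_contra h
        exact hxa (huniq x hx y hy h).1
    · rw [hz' _ (by simpa using hadj)]
      refine Finset.sum_eq_zero fun x hx => Finset.sum_eq_zero fun y hy => ?_
      exact m.jump_eq_zero hw fun h => hadj (m.eq_of_mem_edges huv hx hy h).1
  rw [← Finset.sum_congr rfl fun u _ => key u, Finset.sum_comm]
  refine Finset.sum_eq_zero fun x hx => ?_
  rw [← Finset.sum_biUnion fun u _ u' _ h => Finset.disjoint_left.2 fun a ha ha' =>
    h (m.eq_of_mem ha ha'), ← sum_jump w x]
  -- Grid edges from `x` to points outside all branch sets carry no jump, so the sum over `T` is the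
  -- full sum around `x`.
  set T := Finset.univ.biUnion m.S with hT
  have h1 : ∑ y ∈ T, jump w x y = ∑ y ∈ T ∪ nbrs x, jump w x y := by
    refine Finset.sum_subset Finset.subset_union_left fun y _ hy => m.jump_eq_zero hw fun h => hy ?_
    rw [hT, Finset.mem_biUnion]
    rcases h with ⟨t, a, ha, b, hb, hab⟩ | ⟨e, he⟩
    · rcases Sym2.eq_iff.1 hab with ⟨rfl, rfl⟩ | ⟨rfl, rfl⟩
      · exact ⟨t, Finset.mem_univ _, hb⟩
      · exact ⟨t, Finset.mem_univ _, ha⟩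
    · rcases Sym2.eq_iff.1 he with ⟨rfl, rfl⟩ | ⟨rfl, rfl⟩
      · exact ⟨_, Finset.mem_univ _, m.Y_mem e⟩
      · exact ⟨_, Finset.mem_univ _, m.X_mem e⟩
  have h2 : ∑ y ∈ nbrs x, jump w x y = ∑ y ∈ T ∪ nbrs x, jump w x y :=
    Finset.sum_subset Finset.subset_union_right fun y _ hy => if_neg hy
  rw [h1, h2]

omit [Fintype V] in
/-- An edge of the graph lifts to a chain of grid edges between base points of its ends. -/
theorem exists_lift (r : V → ℤ × ℤ) (hr : ∀ v, r v ∈ m.S v) (e : G.edgeSet) :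
    ∃ c : Sym2 (ℤ × ℤ) →₀ ZMod 2, (∀ p, c p ≠ 0 → p ∈ m.edges) ∧
      (c s(m.X e, m.Y e) = 1) ∧ (∀ e', e' ≠ e → c s(m.X e', m.Y e') = 0) ∧
      ∀ a, ∑ b ∈ nbrs a, c s(a, b) =
        (if a = r (m.src e) then 1 else 0) + (if a = r (m.tgt e) then 1 else 0) := by
  obtain ⟨c₁, h1, h1'⟩ := (m.conn (m.src e)).exists_chain (hr _) (m.X_mem e)
  obtain ⟨c₂, h2, h2'⟩ := (m.conn (m.tgt e)).exists_chain (m.Y_mem e) (hr _)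
  have hzero : ∀ (v : V) (c : Sym2 (ℤ × ℤ) →₀ ZMod 2),
      (∀ a b, c s(a, b) ≠ 0 → a ∈ (m.S v : Set (ℤ × ℤ)) ∧ b ∈ (m.S v : Set (ℤ × ℤ))) →
      ∀ e', c s(m.X e', m.Y e') = 0 := by
    -- A chain inside one branch set avoids every representing edge, whose ends lie in two different
    -- branch sets.
    intro v c hc e'
    by_contra h
    have h3 := hc _ _ h
    exact m.src_ne_tgt e' ((m.eq_of_mem (m.X_mem e') h3.1).trans (m.eq_of_mem h3.2 (m.Y_mem e')))
  refine ⟨Finsupp.single s(m.X e, m.Y e) 1 + c₁ + c₂, fun p hp => ?_, ?_, fun e' he' => ?_,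
    fun a => ?_⟩
  · by_contra hmem
    apply hp
    simp only [Finsupp.add_apply]
    have h3 : c₁ p = 0 := by
      by_contra h
      induction p with | _ a b => ?_
      exact hmem (.inl ⟨_, a, (h1 a b h).1, b, (h1 a b h).2, rfl⟩)
    have h4 : c₂ p = 0 := by
      by_contra h
      induction p with | _ a b => ?_
      exact hmem (.inl ⟨_, a, (h2 a b h).1, b, (h2 a b h).2, rfl⟩)
    rw [h3, h4, Finsupp.single_apply, if_neg]
    · simp
    · rintro rfl
      exact hmem (.inr ⟨e, rfl⟩)
  · simp [hzero _ _ h1, hzero _ _ h2]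
  · simp only [Finsupp.add_apply, hzero _ _ h1, hzero _ _ h2, add_zero]
    rw [Finsupp.single_apply, if_neg]
    intro h
    apply he'
    rw [← Subtype.coe_inj, ← m.mk_eq e, ← m.mk_eq e']
    have hX := m.X_mem e
    have hY := m.Y_mem e
    rcases Sym2.eq_iff.1 h with ⟨h3, h4⟩ | ⟨h3, h4⟩ <;> rw [h3] at hX <;> rw [h4] at hY
    · rw [m.eq_of_mem hX (m.X_mem e'), m.eq_of_mem hY (m.Y_mem e')]
    · rw [m.eq_of_mem hX (m.Y_mem e'), m.eq_of_mem hY (m.X_mem e'), Sym2.eq_swap]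
  · simp only [Finsupp.add_apply]
    rw [Finset.sum_add_distrib, Finset.sum_add_distrib, h1', h2', sum_nbrs_single (m.Y_mem_nbrs e)]
    have h2 : (2 : ZMod 2) = 0 := rfl
    linear_combination ((if a = m.X e then 1 else 0) + (if a = m.Y e then 1 else 0)) * h2

/-- The degree condition at `v` as a sum over oriented edges, the form in which the boundaries of
lifted edges appear. -/
theorem sum_edges_at_eq_zero [Fintype G.edgeSet] [DecidableEq V] {z : Sym2 V → ZMod 2}
    (hz : z ∈ G.cycleSpace) (v : V) :
    ∑ e : G.edgeSet, z e * ((if v = m.src e then 1 else 0) + (if v = m.tgt e then 1 else 0)) =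
      0 := by
  classical
  have h1 : ∀ e : G.edgeSet,
      z e * ((if v = m.src e then 1 else 0) + (if v = m.tgt e then 1 else 0)) =
      if v ∈ e.1 then z e else 0 := by
    intro e
    have hne := m.src_ne_tgt e
    have hv : v ∈ e.1 ↔ v = m.src e ∨ v = m.tgt e := by rw [← m.mk_eq e, Sym2.mem_iff]
    by_cases hs : v = m.src e
    · rw [if_pos (hv.2 (.inl hs))]
      simp [hs, hne]
    · simp [hv, hs]
  rw [Finset.sum_congr rfl fun e _ => h1 e]
  refine Eq.trans ?_ (hz.2 v)
  symm
  have hadj : ∀ w, z s(v, w) ≠ 0 → s(v, w) ∈ G.edgeSet := fun w hw => by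
    by_contra h
    exact hw (hz.1 _ h)
  refine Finset.sum_bij_ne_zero (fun w _ hw => ⟨s(v, w), hadj w hw⟩) (fun _ _ _ => Finset.mem_univ _)
    ?_ ?_ ?_
  · intro a _ _ b _ _ hab
    exact Sym2.congr_right.1 (congrArg Subtype.val hab)
  · rintro ⟨e, he⟩ _ hne
    have hve : v ∈ e := by
      by_contra h
      simp [h] at hne
    obtain ⟨w, rfl⟩ := hve
    exact ⟨w, Finset.mem_univ _, by simpa using hne, rfl⟩
  · intro a _ ha
    simp

/-- Lift each edge of `z` to a grid chain between base points. The boundaries cancel because `z` is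
a cycle, so the total chain is a coboundary; it lives on the model's edges, so the face function is
constant across all others. -/
theorem exists_jump_eq_of_mem_cycleSpace {z : Sym2 V → ZMod 2} (hz : z ∈ G.cycleSpace) :
    ∃ w : ℤ × ℤ → ZMod 2, (∀ f g, m.faceRel f g → w f = w g) ∧
      ∀ e (h : e ∈ G.edgeSet), z e = jump w (m.X ⟨e, h⟩) (m.Y ⟨e, h⟩) := by
  classical
  choose r hr using m.nonempty
  choose c hc1 hc2 hc3 hc4 using m.exists_lift r hr
  let C : Sym2 (ℤ × ℤ) →₀ ZMod 2 := ∑ e : G.edgeSet, z e • c e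
  have hC : ∀ p, C p = ∑ e : G.edgeSet, z e * c e p := by
    intro p
    simp [C, Finsupp.finsetSum_apply]
  have hrinj : ∀ u v, r u = r v → u = v := fun u v h => m.eq_of_mem (hr u) (h ▸ hr v)
  obtain ⟨w, hw⟩ := exists_jump_eq C fun a => by
    simp only [hC]
    rw [Finset.sum_comm]
    simp only [← Finset.mul_sum, hc4]
    by_cases ha : ∃ v, a = r v
    · obtain ⟨v, rfl⟩ := ha
      refine Eq.trans ?_ (m.sum_edges_at_eq_zero hz v)
      refine Finset.sum_congr rfl fun e _ => ?_
      simp only [(show ∀ u, r v = r u ↔ v = u from fun u => ⟨hrinj v u, fun h => h ▸ rfl⟩)]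
    · push Not at ha
      simp [ha]
  refine ⟨w, ?_, fun e he => ?_⟩
  · rintro _ _ ⟨x, y, hxy, hmem, rfl, rfl⟩
    have h1 := hw x y hxy
    have h2 : C s(x, y) = 0 := by
      rw [hC]
      refine Finset.sum_eq_zero fun e _ => ?_
      by_contra h
      exact hmem (hc1 e _ (right_ne_zero_of_mul h))
    rw [h2, jump, if_pos hxy] at h1
    exact CharTwo.add_eq_zero.1 h1
  · rw [hw _ _ (m.Y_mem_nbrs _), hC, Finset.sum_eq_single_of_mem ⟨e, he⟩ (Finset.mem_univ _),
      hc2, mul_one]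
    intro e' _ he'
    rw [hc3 e' _ he'.symm, mul_zero]

end GridModel

/-- Faces are the classes of grid squares joined across edges outside the model. Jumps of functions
on these classes are exactly the cycle space, and indicators of classes give the face vectors. -/
theorem IsGridMinor.exists_span_faceVec_eq [Fintype V] (h : G.IsGridMinor) :
    ∃ (Q : Type) (L R : Sym2 V → Q),
      Submodule.span (ZMod 2) (Set.range (G.faceVec L R)) = G.cycleSpace := by
  classical
  obtain ⟨m⟩ := h.nonempty_gridModel
  let side (s : ℤ × ℤ → ℤ × ℤ → ℤ × ℤ) (e : Sym2 V) : Quot m.faceRel :=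
    if h : e ∈ G.edgeSet then Quot.mk _ (s (m.X ⟨e, h⟩) (m.Y ⟨e, h⟩)) else Quot.mk _ 0
  have hside : ∀ s e (h : e ∈ G.edgeSet),
      side s e = Quot.mk _ (s (m.X ⟨e, h⟩) (m.Y ⟨e, h⟩)) := fun s e h => dif_pos h
  refine ⟨Quot m.faceRel, side sideA, side sideB, le_antisymm (Submodule.span_le.2 ?_) ?_⟩
  · rintro _ ⟨q, rfl⟩
    refine m.jump_mem_cycleSpace (w := fun f => if Quot.mk m.faceRel f = q then 1 else 0)
      (fun f g hfg => by rw [Quot.sound hfg]) _ (fun e he => ?_) (fun e he => ?_)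
    · rw [jump, if_pos (m.Y_mem_nbrs _)]
      simp [faceVec, he, hside]
    · simp [faceVec, he]
  · intro z hz
    obtain ⟨w, hw, hzw⟩ := m.exists_jump_eq_of_mem_cycleSpace hz
    let w' : Quot m.faceRel → ZMod 2 := Quot.lift w hw
    -- Only classes next to an edge matter, so the sum is finite without knowing that there are
    -- finitely many classes.
    let F : Finset (Quot m.faceRel) :=
      Finset.univ.image (side sideA) ∪ Finset.univ.image (side sideB)
    have : z = ∑ q ∈ F, w' q • G.faceVec (side sideA) (side sideB) q := by
      ext e
      rw [Finset.sum_apply]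
      by_cases he : e ∈ G.edgeSet
      · rw [hzw e he, jump, if_pos (m.Y_mem_nbrs _)]
        simp only [faceVec, he, if_true, Pi.smul_apply, smul_eq_mul, mul_add,
          Finset.sum_add_distrib, mul_ite, mul_one, mul_zero]
        rw [Finset.sum_ite_eq, Finset.sum_ite_eq, if_pos (by simp [F]), if_pos (by simp [F]),
          hside _ _ he, hside _ _ he]
      · rw [hz.1 e he]
        simp [faceVec, he]
    rw [this]
    exact Submodule.sum_mem _ fun q _ => Submodule.smul_mem _ _ (Submodule.subset_span ⟨q, rfl⟩)

end SimpleGraph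

open Filter

/-! ### Approximating compact plane sets by grid cells -/

namespace Grid

/-- The closed unit square of the grid with the given lower left corner contains the given point
of the plane, scaled by `N`. -/
def InCell (N : ℕ) (c : ℤ × ℤ) (x : EuclideanSpace ℝ (Fin 2)) : Prop :=
  (N * x 0 ∈ Set.Icc (c.1 : ℝ) (c.1 + 1)) ∧ N * x 1 ∈ Set.Icc (c.2 : ℝ) (c.2 + 1)

/-- The cells of the grid of mesh `1 / N` that meet a set. -/
def cells (N : ℕ) (K : Set (EuclideanSpace ℝ (Fin 2))) : Set (ℤ × ℤ) :=
  {c | ∃ x ∈ K, InCell N c x}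

theorem exists_inCell (N : ℕ) (x : EuclideanSpace ℝ (Fin 2)) : ∃ c, InCell N c x :=
  ⟨(⌊N * x 0⌋, ⌊N * x 1⌋), ⟨Int.floor_le _, (Int.lt_floor_add_one _).le⟩,
    ⟨Int.floor_le _, (Int.lt_floor_add_one _).le⟩⟩

theorem cells_mono (N : ℕ) {K L : Set (EuclideanSpace ℝ (Fin 2))} (h : K ⊆ L) :
    cells N K ⊆ cells N L := fun _ ⟨x, hx, hc⟩ => ⟨x, h hx, hc⟩

theorem cells_nonempty (N : ℕ) {K : Set (EuclideanSpace ℝ (Fin 2))} (h : K.Nonempty) :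
    (cells N K).Nonempty := by
  obtain ⟨x, hx⟩ := h
  obtain ⟨c, hc⟩ := exists_inCell N x
  exact ⟨c, x, hx, hc⟩

theorem finite_cells (N : ℕ) {K : Set (EuclideanSpace ℝ (Fin 2))} (hK : IsCompact K) :
    (cells N K).Finite := by
  obtain ⟨R, hR⟩ := hK.isBounded.exists_norm_le
  have hb : ∀ x ∈ K, ∀ i, |N * x i| ≤ N * R := by
    intro x hx i
    rw [abs_mul, Nat.abs_cast]
    have h1 : |x i| ≤ R := (PiLp.norm_apply_le x i).trans (hR x hx)
    gcongr
  obtain ⟨B, hB⟩ := exists_nat_gt (N * R + 1)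
  refine ((Set.finite_Icc (-(B : ℤ)) B).prod (Set.finite_Icc (-(B : ℤ)) B)).subset ?_
  rintro ⟨a, b⟩ ⟨x, hx, ⟨h1, h2⟩, h3, h4⟩
  have h5 := abs_le.1 (hb x hx 0)
  have h6 := abs_le.1 (hb x hx 1)
  simp only at h1 h2 h3 h4
  simp only [Set.mem_prod, Set.mem_Icc]
  refine ⟨⟨?_, ?_⟩, ?_, ?_⟩ <;> (rw [← Int.cast_le (R := ℝ)]; push_cast; linarith)

theorem isClosed_inCell (N : ℕ) (c : ℤ × ℤ) : IsClosed {x | InCell N c x} := by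
  refine IsClosed.inter ?_ ?_
  · exact isClosed_Icc.preimage (f := fun x : EuclideanSpace ℝ (Fin 2) => (N : ℝ) * x 0)
      (by fun_prop)
  · exact isClosed_Icc.preimage (f := fun x : EuclideanSpace ℝ (Fin 2) => (N : ℝ) * x 1)
      (by fun_prop)

theorem isConn_cells (N : ℕ) {K : Set (EuclideanSpace ℝ (Fin 2))} (hK : IsCompact K)
    (hconn : IsPreconnected K) : IsConn (cells N K) := by
  intro P hP x hx y hy hPx
  by_contra hPy
  have hcl : ∀ Q : ℤ × ℤ → Prop,
      IsClosed (⋃ c ∈ {c | c ∈ cells N K ∧ Q c}, {x | InCell N c x}) := fun Q =>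
    ((finite_cells N hK).subset fun c hc => hc.1).isClosed_biUnion fun c _ => isClosed_inCell N c
  -- Cells sharing the point `p` differ by at most 1 in each coordinate; diagonal neighbours are
  -- linked through the cell (a', b), which also contains `p`.
  have hstep : ∀ p ∈ K, ∀ a b a' b' : ℤ, InCell N (a, b) p → InCell N (a', b') p →
      P (a, b) → P (a', b') := by
    intro p hp a b a' b' h h' hPab
    have hm : InCell N (a', b) p := ⟨h'.1, h.2⟩
    have ha1 : a ≤ a' + 1 := by
      have := h.1.1.trans h'.1.2
      exact_mod_cast this
    have ha2 : a' ≤ a + 1 := by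
      have := h'.1.1.trans h.1.2
      exact_mod_cast this
    have hb1 : b ≤ b' + 1 := by
      have := h.2.1.trans h'.2.2
      exact_mod_cast this
    have hb2 : b' ≤ b + 1 := by
      have := h'.2.1.trans h.2.2
      exact_mod_cast this
    have hPm : P (a', b) := by
      by_cases haa : a = a'
      · exact haa ▸ hPab
      · refine hP _ ⟨p, hp, h⟩ _ ⟨p, hp, hm⟩ ?_ hPab
        simp only [mem_nbrs, Prod.mk.injEq, and_true]
        omega
    by_cases hbb : b = b'
    · exact hbb ▸ hPm
    · refine hP _ ⟨p, hp, hm⟩ _ ⟨p, hp, h'⟩ ?_ hPm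
      simp only [mem_nbrs, Prod.mk.injEq, true_and]
      omega
  obtain ⟨px, hpx, hcx⟩ := hx
  obtain ⟨py, hpy, hcy⟩ := hy
  obtain ⟨p, hp, h1, h2⟩ := isPreconnected_closed_iff.1 hconn _ _ (hcl P) (hcl fun c => ¬ P c)
    (fun p hp => by
      obtain ⟨c, hc⟩ := exists_inCell N p
      by_cases hPc : P c
      · exact .inl (Set.mem_biUnion (x := c) ⟨⟨p, hp, hc⟩, hPc⟩ hc)
      · exact .inr (Set.mem_biUnion (x := c) ⟨⟨p, hp, hc⟩, hPc⟩ hc))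
    ⟨px, hpx, Set.mem_biUnion (x := x) ⟨⟨px, hpx, hcx⟩, hPx⟩ hcx⟩
    ⟨py, hpy, Set.mem_biUnion (x := y) ⟨⟨py, hpy, hcy⟩, hPy⟩ hcy⟩
  simp only [Set.mem_iUnion] at h1 h2
  obtain ⟨c, ⟨-, hc⟩, hpc⟩ := h1
  obtain ⟨c', ⟨-, hc'⟩, hpc'⟩ := h2
  exact hc' (hstep p hp _ _ _ _ hpc hpc' hc)

theorem eventually_disjoint_cells {K L : Set (EuclideanSpace ℝ (Fin 2))} (hK : IsCompact K)
    (hL : IsCompact L) (h : Disjoint K L) : ∀ᶠ N in atTop, Disjoint (cells N K) (cells N L) := by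
  obtain ⟨δ, hδ, hd⟩ := h.exists_thickenings hK hL.isClosed
  -- Two points of one cell differ by at most 1/N in each coordinate, so their distance is at most
  -- 2/N < δ.
  obtain ⟨M, hM⟩ := exists_nat_gt (2 / δ)
  filter_upwards [eventually_ge_atTop M] with N hN
  rw [Set.disjoint_left]
  rintro ⟨a, b⟩ ⟨x, hx, ⟨h1, h2⟩, h3, h4⟩ ⟨y, hy, ⟨h5, h6⟩, h7, h8⟩
  simp only at h1 h2 h3 h4 h5 h6 h7 h8
  have hNδ : 2 < N * δ := by
    have : 2 / δ < N := hM.trans_le (by exact_mod_cast hN)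
    rwa [div_lt_iff₀ hδ] at this
  have hNpos : (0 : ℝ) < N := by
    by_contra hcon
    nlinarith
  have hdist : dist x y < δ := by
    have e0 : (N : ℝ) * |x 0 - y 0| ≤ 1 := by
      rw [← Nat.abs_cast N, ← abs_mul, mul_sub, abs_le]
      constructor <;> linarith
    have e1 : (N : ℝ) * |x 1 - y 1| ≤ 1 := by
      rw [← Nat.abs_cast N, ← abs_mul, mul_sub, abs_le]
      constructor <;> linarith
    have e2 : dist x y ≤ |x 0 - y 0| + |x 1 - y 1| := by
      rw [EuclideanSpace.dist_eq, Fin.sum_univ_two, Real.dist_eq, Real.dist_eq]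
      refine Real.sqrt_le_iff.2 ⟨by positivity, ?_⟩
      nlinarith [abs_nonneg (x 0 - y 0), abs_nonneg (x 1 - y 1)]
    nlinarith
  exact Set.disjoint_left.1 hd (Metric.self_subset_thickening hδ K hx)
    (Metric.mem_thickening_iff.2 ⟨y, hy, hdist⟩)

/-- Take everything reachable from `a` within `C \ B`. If it never bordered `B`, it would be closed
under neighbours in `C` and would contain `b`. -/
theorem IsConn.exists_subset_diff {C B : Set (ℤ × ℤ)} (hC : IsConn C) {a b : ℤ × ℤ}
    (ha : a ∈ C) (haB : a ∉ B) (hb : b ∈ C) (hbB : b ∈ B) :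
    ∃ X ⊆ C \ B, a ∈ X ∧ IsConn X ∧ ∃ x ∈ X, ∃ y ∈ B, y ∈ nbrs x := by
  let R : ℤ × ℤ → ℤ × ℤ → Prop := fun x y => y ∈ C \ B ∧ y ∈ nbrs x
  have hsub : {x | Relation.ReflTransGen R a x} ⊆ C \ B := by
    intro x hx
    rcases Relation.ReflTransGen.cases_tail hx with rfl | ⟨_, _, h, _⟩
    · exact ⟨ha, haB⟩
    · exact h
  refine ⟨{x | Relation.ReflTransGen R a x}, hsub, .refl, ?_, ?_⟩
  · intro P hP
    have key : ∀ x, Relation.ReflTransGen R a x → (P a ↔ P x) := by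
      intro x hx
      induction hx with
      | refl => rfl
      | tail hp hpq ih =>
        exact ih.trans ⟨hP _ hp _ (hp.tail hpq) hpq.2,
          hP _ (hp.tail hpq) _ hp (mem_nbrs_comm.1 hpq.2)⟩
    intro x hx y hy h
    exact (key y hy).1 ((key x hx).2 h)
  · by_contra! hcon
    refine (hsub (hC (fun x => Relation.ReflTransGen R a x) ?_ a ha b hb .refl)).2 hbB
    intro x _ y hy hxy hx
    exact hx.tail ⟨⟨hy, fun hyB => hcon x hx y hyB hxy⟩, hxy⟩

theorem IsConn.union_iUnion {ι : Type*} {A : Set (ℤ × ℤ)} {X : ι → Set (ℤ × ℤ)} (hA : IsConn A)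
    (hX : ∀ i, IsConn (X i)) (hAX : ∀ i, (A ∩ X i).Nonempty) : IsConn (A ∪ ⋃ i, X i) := by
  intro P hP
  have hPA := hA P fun x hx y hy => hP x (.inl hx) y (.inl hy)
  have hPX := fun i => hX i P fun x hx y hy =>
    hP x (.inr (Set.mem_iUnion_of_mem i hx)) y (.inr (Set.mem_iUnion_of_mem i hy))
  have key : ∀ x ∈ A ∪ ⋃ i, X i, ∃ a ∈ A, P x ↔ P a := by
    rintro x (hx | hx)
    · exact ⟨x, hx, Iff.rfl⟩
    · obtain ⟨i, hi⟩ := Set.mem_iUnion.1 hx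
      obtain ⟨a, ha, hai⟩ := hAX i
      exact ⟨a, ha, hPX i x hi a hai, hPX i a hai x hi⟩
  intro x hx y hy h
  obtain ⟨a, ha, hxa⟩ := key x hx
  obtain ⟨b, hb, hyb⟩ := key y hy
  exact hyb.2 (hPA a ha b hb (hxa.1 h))

end Grid

/-! ### From a plane drawing to a grid minor -/

namespace PlaneDrawing

variable {V : Type*} {G : SimpleGraph V}

theorem exists_paths (D : PlaneDrawing G) (e : G.edgeSet) :
    ∃ (u v : V) (γ : Path (D.point u) (D.point v)), s(u, v) = e.1 ∧ Function.Injective γ ∧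
      Set.range γ = D.arc e := by
  obtain ⟨e, he⟩ := e
  induction e with | _ u v => ?_
  obtain ⟨γ, h1, h2⟩ := D.isPlaneArc u v he
  exact ⟨u, v, γ, rfl, h1, h2⟩

/-- A drawing with a chosen orientation and parametrization of every edge. -/
structure Param (D : PlaneDrawing G) where
  /-- the first end of an edge -/
  src : G.edgeSet → V
  /-- the second end of an edge -/
  tgt : G.edgeSet → V
  /-- the parametrization of an edge -/
  path : ∀ e, Path (D.point (src e)) (D.point (tgt e))
  mk_eq : ∀ e, s(src e, tgt e) = e.1
  injective : ∀ e, Function.Injective (path e)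
  range_eq : ∀ e, Set.range (path e) = D.arc e

theorem nonempty_param (D : PlaneDrawing G) : Nonempty D.Param := by
  choose src tgt path h1 h2 h3 using D.exists_paths
  exact ⟨⟨src, tgt, path, h1, h2, h3⟩⟩

namespace Param

variable {D : PlaneDrawing G} (p : D.Param)

open unitInterval

/-- The parameters in the first third of the unit interval. -/
def firstThird : Set I := {t | (t : ℝ) ≤ 1 / 3}

/-- The parameters in the middle third of the unit interval. -/
def middleThird : Set I := {t | 1 / 3 ≤ (t : ℝ) ∧ (t : ℝ) ≤ 2 / 3}

/-- The parameters in the last third of the unit interval. -/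
def lastThird : Set I := {t | 2 / 3 ≤ (t : ℝ)}

open Classical in
/-- The pieces of the drawing near a vertex. -/
noncomputable def piece (v : V) : Option (G.edgeSet × Bool) → Set (EuclideanSpace ℝ (Fin 2))
  | none => {D.point v}
  | some (e, true) => if p.src e = v then p.path e '' firstThird else {D.point v}
  | some (e, false) => if p.tgt e = v then p.path e '' lastThird else {D.point v}

/-- The part of the drawing near a vertex: the thirds of the edges next to it. -/
noncomputable def star (v : V) : Set (EuclideanSpace ℝ (Fin 2)) := ⋃ i, p.piece v i

/-- The middle third of an edge. -/
def middle (e : G.edgeSet) : Set (EuclideanSpace ℝ (Fin 2)) := p.path e '' middleThird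

theorem ordConnected_firstThird : firstThird.OrdConnected :=
  ⟨fun _ _ y hy z hz => le_trans (show (z : ℝ) ≤ y from hz.2) hy⟩

theorem ordConnected_middleThird : middleThird.OrdConnected :=
  ⟨fun x hx y hy z hz => ⟨hx.1.trans (show (x : ℝ) ≤ z from hz.1),
    le_trans (show (z : ℝ) ≤ y from hz.2) hy.2⟩⟩

theorem ordConnected_lastThird : lastThird.OrdConnected :=
  ⟨fun x hx _ _ z hz => le_trans hx (show (x : ℝ) ≤ z from hz.1)⟩

theorem isClosed_firstThird : IsClosed firstThird :=
  isClosed_le continuous_subtype_val continuous_const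

theorem isClosed_lastThird : IsClosed lastThird :=
  isClosed_le continuous_const continuous_subtype_val

theorem isClosed_middleThird : IsClosed middleThird :=
  (isClosed_le continuous_const continuous_subtype_val).inter
    (isClosed_le continuous_subtype_val continuous_const)

theorem isPreconnected_middle (e : G.edgeSet) : IsPreconnected (p.middle e) :=
  (ordConnected_middleThird.isPreconnected).image _ (p.path e).continuous.continuousOn

theorem isCompact_middle (e : G.edgeSet) : IsCompact (p.middle e) :=
  isClosed_middleThird.isCompact.image (p.path e).continuous

/-- This is why `piece` falls back to a single point for edges that do not end at `v`: all pieces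
share a point, so their union is connected. -/
theorem point_mem_piece (v : V) (i : Option (G.edgeSet × Bool)) : D.point v ∈ p.piece v i := by
  rcases i with _ | ⟨e, _ | _⟩
  · simp [piece]
  · by_cases h : p.tgt e = v
    · subst h
      simp only [piece, if_true]
      exact ⟨1, by norm_num [lastThird], (p.path e).target⟩
    · simp [piece, h]
  · by_cases h : p.src e = v
    · subst h
      simp only [piece, if_true]
      exact ⟨0, by norm_num [firstThird], (p.path e).source⟩
    · simp [piece, h]

theorem isPreconnected_piece (v : V) (i : Option (G.edgeSet × Bool)) :
    IsPreconnected (p.piece v i) := by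
  rcases i with _ | ⟨e, _ | _⟩
  · exact isPreconnected_singleton
  · by_cases h : p.tgt e = v
    · simp only [piece, h, if_true]
      exact ordConnected_lastThird.isPreconnected.image _ (p.path e).continuous.continuousOn
    · simp only [piece, h, if_false]
      exact isPreconnected_singleton
  · by_cases h : p.src e = v
    · simp only [piece, h, if_true]
      exact ordConnected_firstThird.isPreconnected.image _ (p.path e).continuous.continuousOn
    · simp only [piece, h, if_false]
      exact isPreconnected_singleton

theorem isCompact_piece (v : V) (i : Option (G.edgeSet × Bool)) : IsCompact (p.piece v i) := by
  rcases i with _ | ⟨e, _ | _⟩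
  · exact isCompact_singleton
  · by_cases h : p.tgt e = v
    · simp only [piece, h, if_true]
      exact isClosed_lastThird.isCompact.image (p.path e).continuous
    · simp only [piece, h, if_false]
      exact isCompact_singleton
  · by_cases h : p.src e = v
    · simp only [piece, h, if_true]
      exact isClosed_firstThird.isCompact.image (p.path e).continuous
    · simp only [piece, h, if_false]
      exact isCompact_singleton

theorem isPreconnected_star (v : V) : IsPreconnected (p.star v) :=
  isPreconnected_iUnion ⟨D.point v, Set.mem_iInter.2 (p.point_mem_piece v)⟩
    (p.isPreconnected_piece v)

theorem isCompact_star [Finite V] (v : V) : IsCompact (p.star v) :=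
  isCompact_iUnion (p.isCompact_piece v)

theorem image_firstThird_subset_star (e : G.edgeSet) :
    p.path e '' firstThird ⊆ p.star (p.src e) := by
  refine subset_trans ?_ (Set.subset_iUnion _ (some (e, true)))
  simp [piece]

theorem image_lastThird_subset_star (e : G.edgeSet) :
    p.path e '' lastThird ⊆ p.star (p.tgt e) := by
  refine subset_trans ?_ (Set.subset_iUnion _ (some (e, false)))
  simp [piece]

theorem path_mem_arc (e : G.edgeSet) (t : I) : p.path e t ∈ D.arc e :=
  p.range_eq e ▸ Set.mem_range_self t

theorem eq_of_path_eq_point {e : G.edgeSet} {t : I} {w : V} (h : p.path e t = D.point w) :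
    (p.src e = w ∧ t = 0) ∨ (p.tgt e = w ∧ t = 1) := by
  have hw := D.mem_of_point_mem_arc e w (h ▸ p.path_mem_arc e t)
  rw [← p.mk_eq e, Sym2.mem_iff] at hw
  rcases hw with rfl | rfl
  · exact .inl ⟨rfl, p.injective e (h.trans (p.path e).source.symm)⟩
  · exact .inr ⟨rfl, p.injective e (h.trans (p.path e).target.symm)⟩

theorem eq_point_of_path_eq_path {e f : G.edgeSet} (hef : e ≠ f) {s t : I}
    (h : p.path e s = p.path f t) : ∃ w, p.path e s = D.point w := by
  obtain ⟨w, -, hw⟩ := D.arc_inter_arc e f hef ⟨p.path_mem_arc e s, h ▸ p.path_mem_arc f t⟩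
  exact ⟨w, hw.symm⟩

theorem mem_star {v : V} {x : EuclideanSpace ℝ (Fin 2)} (hx : x ∈ p.star v) :
    x = D.point v ∨ ∃ e t, x = p.path e t ∧
      ((p.src e = v ∧ (t : ℝ) ≤ 1 / 3) ∨ (p.tgt e = v ∧ 2 / 3 ≤ (t : ℝ))) := by
  obtain ⟨i, hi⟩ := Set.mem_iUnion.1 hx
  rcases i with _ | ⟨e, _ | _⟩
  · exact .inl hi
  · by_cases h : p.tgt e = v
    · simp only [piece, h, if_true] at hi
      obtain ⟨t, ht, rfl⟩ := hi
      exact .inr ⟨e, t, rfl, .inr ⟨h, ht⟩⟩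
    · simp only [piece, h, if_false] at hi
      exact .inl hi
  · by_cases h : p.src e = v
    · simp only [piece, h, if_true] at hi
      obtain ⟨t, ht, rfl⟩ := hi
      exact .inr ⟨e, t, rfl, .inl ⟨h, ht⟩⟩
    · simp only [piece, h, if_false] at hi
      exact .inl hi

/-- A point shared with another arc is a vertex, and a vertex lying on one of the thirds at `v` can
only be `v`; on the same arc, injectivity fixes the parameter. -/
theorem of_path_mem_star {v : V} {e : G.edgeSet} {t : I} (h : p.path e t ∈ p.star v) :
    (p.src e = v ∧ (t : ℝ) ≤ 1 / 3) ∨ (p.tgt e = v ∧ 2 / 3 ≤ (t : ℝ)) := by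
  have hpt : p.path e t = D.point v →
      (p.src e = v ∧ (t : ℝ) ≤ 1 / 3) ∨ (p.tgt e = v ∧ 2 / 3 ≤ (t : ℝ)) := by
    intro h
    rcases p.eq_of_path_eq_point h with ⟨h1, rfl⟩ | ⟨h1, rfl⟩
    · exact .inl ⟨h1, by norm_num⟩
    · exact .inr ⟨h1, by norm_num⟩
  rcases p.mem_star h with h | ⟨f, s, hfs, hs⟩
  · exact hpt h
  · by_cases hef : f = e
    · subst hef
      rwa [p.injective f hfs]
    · obtain ⟨w, hw⟩ := p.eq_point_of_path_eq_path hef hfs.symm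
      apply hpt
      rw [hfs, hw]
      rcases p.eq_of_path_eq_point hw with ⟨h1, rfl⟩ | ⟨h1, rfl⟩
      · norm_num at hs
        rw [← h1, hs]
      · norm_num at hs
        rw [← h1, hs]

theorem disjoint_star {u v : V} (huv : u ≠ v) : Disjoint (p.star u) (p.star v) := by
  rw [Set.disjoint_left]
  intro x hu hv
  rcases p.mem_star hu with rfl | ⟨e, t, rfl, h⟩
  · rcases p.mem_star hv with h | ⟨e, t, h, h'⟩
    · exact huv (D.point_injective h)
    · rcases p.eq_of_path_eq_point h.symm with ⟨h1, rfl⟩ | ⟨h1, rfl⟩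
      · norm_num at h'
        exact huv (h1.symm.trans h')
      · norm_num at h'
        exact huv (h1.symm.trans h')
  · rcases p.of_path_mem_star hv with h' | h' <;> rcases h with h | h
    · exact huv (h.1.symm.trans h'.1)
    · linarith [h.2, h'.2]
    · linarith [h.2, h'.2]
    · exact huv (h.1.symm.trans h'.1)

theorem disjoint_middle_star {e : G.edgeSet} {v : V} (hs : p.src e ≠ v) (ht : p.tgt e ≠ v) :
    Disjoint (p.middle e) (p.star v) := by
  rw [Set.disjoint_left]
  rintro _ ⟨t, -, rfl⟩ hv
  rcases p.of_path_mem_star hv with h | h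
  · exact hs h.1
  · exact ht h.1

theorem disjoint_middle {e f : G.edgeSet} (hef : e ≠ f) :
    Disjoint (p.middle e) (p.middle f) := by
  rw [Set.disjoint_left]
  rintro _ ⟨t, ht, rfl⟩ ⟨s, -, hs⟩
  obtain ⟨w, hw⟩ := p.eq_point_of_path_eq_path hef hs.symm
  rcases p.eq_of_path_eq_point hw with ⟨-, rfl⟩ | ⟨-, rfl⟩
  · norm_num [middleThird] at ht
  · norm_num [middleThird] at ht

theorem middle_inter_star_src (e : G.edgeSet) : (p.middle e ∩ p.star (p.src e)).Nonempty := by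
  refine ⟨p.path e ⟨1 / 3, by norm_num, by norm_num⟩, ⟨_, ?_, rfl⟩,
    p.image_firstThird_subset_star e ⟨_, ?_, rfl⟩⟩
  · norm_num [middleThird]
  · norm_num [firstThird]

theorem middle_inter_star_tgt (e : G.edgeSet) : (p.middle e ∩ p.star (p.tgt e)).Nonempty := by
  refine ⟨p.path e ⟨2 / 3, by norm_num, by norm_num⟩, ⟨_, ?_, rfl⟩,
    p.image_lastThird_subset_star e ⟨_, ?_, rfl⟩⟩
  · norm_num [middleThird]
  · norm_num [lastThird]

theorem src_ne_tgt (e : G.edgeSet) : p.src e ≠ p.tgt e := by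
  have := e.2
  rw [← p.mk_eq e] at this
  exact G.ne_of_adj this

theorem isGridMinor [Finite V] (p : D.Param) : G.IsGridMinor := by
  classical
  obtain ⟨N, hN1, hN2, hN3⟩ : ∃ N,
      (∀ u v, u ≠ v → Disjoint (cells N (p.star u)) (cells N (p.star v))) ∧
      (∀ e v, p.src e ≠ v → p.tgt e ≠ v →
        Disjoint (cells N (p.middle e)) (cells N (p.star v))) ∧
      (∀ e f, e ≠ f → Disjoint (cells N (p.middle e)) (cells N (p.middle f))) := by
    -- Finitely many pairs of disjoint compact sets are separated by one fine mesh.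
    refine Eventually.exists (f := atTop) (Eventually.and ?_ (Eventually.and ?_ ?_))
    · simp only [eventually_all]
      exact fun u v h => eventually_disjoint_cells (p.isCompact_star u) (p.isCompact_star v)
        (p.disjoint_star h)
    · simp only [eventually_all]
      exact fun e v hs ht => eventually_disjoint_cells (p.isCompact_middle e) (p.isCompact_star v)
        (p.disjoint_middle_star hs ht)
    · simp only [eventually_all]
      exact fun e f h => eventually_disjoint_cells (p.isCompact_middle e) (p.isCompact_middle f)
        (p.disjoint_middle h)
  have hX : ∀ e, ∃ X ⊆ cells N (p.middle e) \ cells N (p.star (p.tgt e)),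
      (cells N (p.star (p.src e)) ∩ X).Nonempty ∧ IsConn X ∧
        ∃ x ∈ X, ∃ y ∈ cells N (p.star (p.tgt e)), y ∈ nbrs x := by
    intro e
    obtain ⟨a, ha⟩ := cells_nonempty N (p.middle_inter_star_src e)
    obtain ⟨b, hb⟩ := cells_nonempty N (p.middle_inter_star_tgt e)
    have ha1 := cells_mono N Set.inter_subset_left ha
    have ha2 := cells_mono N Set.inter_subset_right ha
    have hb1 := cells_mono N Set.inter_subset_left hb
    have hb2 := cells_mono N Set.inter_subset_right hb
    obtain ⟨X, hX, haX, hconn, hxy⟩ :=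
      (isConn_cells N (p.isCompact_middle e) (p.isPreconnected_middle e)).exists_subset_diff ha1
        (Set.disjoint_left.1 (hN1 _ _ (p.src_ne_tgt e)) ha2) hb1 hb2
    exact ⟨X, hX, ⟨a, ha2, haX⟩, hconn, hxy⟩
  choose X hXsub hXne hXconn x hx y hy hxy using hX
  -- The branch set of `v` is its star with the trimmed middles of its outgoing edges; each trimmed
  -- middle stops one grid edge short of the target star.
  let S : V → Set (ℤ × ℤ) := fun v =>
    cells N (p.star v) ∪ ⋃ e : {e : G.edgeSet // p.src e = v}, X e
  have hfin : ∀ v, (S v).Finite := fun v =>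
    (finite_cells N (p.isCompact_star v)).union <| Set.finite_iUnion fun e =>
      (finite_cells N (p.isCompact_middle e)).subset ((hXsub e).trans Set.sdiff_subset)
  have hXstar : ∀ e v, p.src e ≠ v → Disjoint (X e) (cells N (p.star v)) := by
    intro e v hev
    by_cases htv : p.tgt e = v
    · subst htv
      exact Set.disjoint_left.2 fun a ha => (hXsub e ha).2
    · exact (hN2 e v hev htv).mono_left ((hXsub e).trans Set.sdiff_subset)
  have hdisj : ∀ u v, u ≠ v → Disjoint (S u) (S v) := by
    intro u v huv
    rw [Set.disjoint_union_left, Set.disjoint_union_right, Set.disjoint_union_right]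
    refine ⟨⟨hN1 u v huv, ?_⟩, ?_, ?_⟩
    · rw [Set.disjoint_iUnion_right]
      exact fun e => (hXstar e u (e.2.trans_ne huv.symm)).symm
    · rw [Set.disjoint_iUnion_left]
      exact fun e => hXstar e v (e.2.trans_ne huv)
    · simp only [Set.disjoint_iUnion_left, Set.disjoint_iUnion_right]
      intro e f
      refine (hN3 f e ?_).mono ((hXsub _).trans Set.sdiff_subset) ((hXsub _).trans Set.sdiff_subset)
      intro hef
      exact huv (f.2.symm.trans (hef ▸ e.2))
  have hadj : ∀ e, ∃ a ∈ S (p.src e), ∃ b ∈ S (p.tgt e), b ∈ nbrs a := fun e =>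
    ⟨x e, .inr (Set.mem_iUnion_of_mem ⟨e, rfl⟩ (hx e)), y e, .inl (hy e), hxy e⟩
  refine ⟨fun v => (hfin v).toFinset, fun v => ?_, fun v => ?_, fun u v huv => ?_,
    fun u v huv => ?_⟩
  · rw [Set.Finite.toFinset_nonempty]
    exact (cells_nonempty N ⟨D.point v, Set.mem_iUnion.2 ⟨none, p.point_mem_piece v none⟩⟩).inl
  · rw [Set.Finite.coe_toFinset]
    refine (isConn_cells N (p.isCompact_star v) (p.isPreconnected_star v)).union_iUnion
      (fun e => hXconn _) ?_
    rintro ⟨e, rfl⟩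
    exact hXne e
  · rw [Set.Finite.disjoint_toFinset]
    exact hdisj u v huv
  · simp only [Set.Finite.mem_toFinset]
    have h := hadj ⟨s(u, v), huv⟩
    rcases Sym2.eq_iff.1 (p.mk_eq ⟨s(u, v), huv⟩) with ⟨h1, h2⟩ | ⟨h1, h2⟩ <;> rw [h1, h2] at h
    · exact h
    · obtain ⟨a, ha, b, hb, hab⟩ := h
      exact ⟨b, hb, a, ha, mem_nbrs_comm.1 hab⟩

end Param

end PlaneDrawing

theorem IsPlanarGraph.isGridMinor {V : Type*} [Finite V] {G : SimpleGraph V}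
    (h : IsPlanarGraph G) : G.IsGridMinor := by
  obtain ⟨D⟩ := h
  obtain ⟨p⟩ := D.nonempty_param
  exact p.isGridMinor

/-! ### Colouring by induction -/

namespace SimpleGraph

theorem Colorable.of_induce_compl_singleton {V : Type*} {G : SimpleGraph V} {v : V}
    [Fintype (G.neighborSet v)] {n : ℕ} (h : (G.induce {v}ᶜ).Colorable n) (hdeg : G.degree v < n) :
    G.Colorable n := by
  classical
  obtain ⟨C⟩ := h
  let c : V → Fin n := fun w => if hw : w ∈ ({v}ᶜ : Set V) then C ⟨w, hw⟩ else ⟨0, by omega⟩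
  obtain ⟨k, hk⟩ : ∃ k, k ∉ (G.neighborFinset v).image c := by
    by_contra! hcon
    have := Finset.card_le_card (fun k _ => hcon k : (Finset.univ : Finset (Fin n)) ⊆ _)
    have h2 := this.trans Finset.card_image_le
    rw [Finset.card_univ, Fintype.card_fin, card_neighborFinset_eq_degree] at h2
    omega
  refine ⟨Coloring.mk (fun w => if w = v then k else c w) ?_⟩
  intro a b hab
  have hne : ∀ w, G.Adj v w → k ≠ c w := fun w hw hkw =>
    hk (Finset.mem_image.2 ⟨w, (mem_neighborFinset _ _ _).2 hw, hkw.symm⟩)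
  by_cases ha : a = v
  · subst ha
    simpa [hab.ne.symm] using hne b hab
  · by_cases hb : b = v
    · subst hb
      simpa [ha] using (hne a hab.symm).symm
    · have hab' : (G.induce {v}ᶜ).Adj ⟨a, ha⟩ ⟨b, hb⟩ := hab
      have := C.valid hab'
      simp only [ha, hb, if_false, c]
      rwa [dif_pos, dif_pos]

/-- The induction runs over grid minors, which pass to induced subgraphs by forgetting a branch set;
cycles of the subgraph are cycles of `G` of the same length. -/
theorem IsGridMinor.colorable_three {V : Type*} [Finite V] {G : SimpleGraph V}
    (h : G.IsGridMinor)
    (hcycles : ∀ (v : V) (c : G.Walk v v), c.IsCycle → ¬ (4 ≤ c.length ∧ c.length ≤ 11)) :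
    G.Colorable 3 := by
  classical
  induction hn : Nat.card V using Nat.strong_induction_on generalizing V with | _ n ih => ?_
  have := Fintype.ofFinite V
  rcases isEmpty_or_nonempty V with hV | hV
  · exact Colorable.of_isEmpty 3
  obtain ⟨Q, L, R, hspan⟩ := h.exists_span_faceVec_eq
  obtain ⟨v, hv⟩ := exists_degree_le_two L R hspan hcycles
  refine Colorable.of_induce_compl_singleton (v := v) ?_ (Nat.lt_succ_of_le hv)
  refine ih _ ?_ (h.comap (Embedding.induce _)) (fun u c hc => ?_) rfl
  · rw [← hn, Nat.card_eq_fintype_card, Nat.card_eq_fintype_card]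
    exact Fintype.card_subtype_lt (x := v) (by simp)
  · let f : G.induce {v}ᶜ ↪g G := Embedding.induce _
    have := hcycles _ (c.map f.toHom) (hc.map f.injective)
    rwa [Walk.length_map] at this

end SimpleGraph

theorem mainTheorem3 {V : Type*} [Finite V] (G : SimpleGraph V) (hplanar : IsPlanarGraph G)
    (hcycles : ∀ (v : V) (c : G.Walk v v), c.IsCycle → ¬ (4 ≤ c.length ∧ c.length ≤ 11)) :
    G.Colorable 3 :=
  hplanar.isGridMinor.colorable_three hcycles
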